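/- Consider the infinite hexagonal grid, i.e. the graph whose vertices and edges are the corners and sides of the tiling of the plane by regular hexagons. A fire breaks out at a single vertex $f$ on turn $1$. On every even turn firefighters protect some vertices that are not on fire, and on every odd turn after the first the fire spreads from the burning vertices to all adjacent unprotected vertices; burning vertices stay on fire and protected vertices stay protected. The fire is contained if on some turn all but finitely many vertices are saved, where a vertex is saved if it is protected or lies in a component of the subgraph induced by the vertices that are not protected which contains no burning vertex. For every starting vertex $f$ there is a strategy for the firefighters such that, for every integer $\tau\ge 1$, if one additional firefighter is available on turn $2\tau$, so that at most two vertices are protected on turn $2\tau$ and at most one vertex on every other even turn, then the strategy contains the fire. The strategy does not need to know $\tau$ in advance: the vertices that it protects on a turn $2t$ do not depend on $\tau$ as long as $\tau>t$. -/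

import Mathlib

namespace Firefighter

/-- The set of protected vertices on turn `n`, when the firefighters newly protect the set `A s`
on the even turn `2 * s`, for `s = 1, 2, 3, …` (the entry `A 0` is never used). -/
def protectedOn {V : Type*} (A : ℕ → Finset V) (n : ℕ) : Set V :=
  {v | ∃ s : ℕ, 1 ≤ s ∧ 2 * s ≤ n ∧ v ∈ A s}

/-- The set of vertices on fire on turn `n`, when the fire starts on turn `1` at the set `F₀`. On
even turns nothing new burns. On the odd turns `3, 5, 7, …` the set of burning vertices becomes its
closed neighborhood except for the protected vertices. (Turn `0` is not part of the process.) -/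
def fireOn {V : Type*} (G : SimpleGraph V) (F₀ : Set V) (A : ℕ → Finset V) : ℕ → Set V
  | 0 => F₀
  | 1 => F₀
  | n + 2 =>
    if Even (n + 2) then fireOn G F₀ A (n + 1)
    else {v | v ∈ fireOn G F₀ A (n + 1) ∨ ∃ u ∈ fireOn G F₀ A (n + 1), G.Adj u v} \
      protectedOn A (n + 1)

/-- The moves `A` are legal with `b t` firefighters on turn `2 * t`: on each even turn at most that
many vertices are newly protected, and none of them is on fire. -/
def IsLegal {V : Type*} (G : SimpleGraph V) (F₀ : Set V) (b : ℕ → ℕ) (A : ℕ → Finset V) : Prop :=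
  ∀ t : ℕ, 1 ≤ t → (A t).card ≤ b t ∧ ∀ v ∈ A t, v ∉ fireOn G F₀ A (2 * t - 1)

/-- The vertex `v` is saved on turn `n`: it is protected, or it lies in a component of the subgraph
induced by the vertices that are not protected, and that component has no burning vertex. -/
def IsSavedOn {V : Type*} (G : SimpleGraph V) (F₀ : Set V) (A : ℕ → Finset V) (n : ℕ) (v : V) :
    Prop :=
  v ∈ protectedOn A n ∨
    ∃ hv : v ∈ (protectedOn A n)ᶜ, ∀ (u : V) (hu : u ∈ (protectedOn A n)ᶜ),
      u ∈ fireOn G F₀ A n → ¬ (G.induce (protectedOn A n)ᶜ).Reachable ⟨v, hv⟩ ⟨u, hu⟩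

/-- The fire is contained by the moves `A`: on some turn all but finitely many vertices are
saved. -/
def IsContained {V : Type*} (G : SimpleGraph V) (F₀ : Set V) (A : ℕ → Finset V) : Prop :=
  ∃ n : ℕ, 1 ≤ n ∧ {v : V | ¬ IsSavedOn G F₀ A n v}.Finite

/-- Let `A τ` be the moves that are made when the extra firefighter turns up on turn `2 * τ`. The
firefighters do not know `τ` in advance: what they do on a turn `2 * t` before the extra firefighter
turns up is the same for all `τ > t`. -/
def IsNonanticipating {V : Type*} (A : ℕ → ℕ → Finset V) : Prop :=
  ∀ τ τ' t : ℕ, 1 ≤ t → t < τ → t < τ' → A τ t = A τ' t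

/-- The vertices of the hexagonal grid: the pair `(i, j)` stands for the point
`(i * √3 / 2, j / 2)` of the plane, which is a corner of the tiling by regular hexagons of side
length `1` exactly when `(i mod 2, j mod 6)` is one of the four pairs below. -/
def HexVertex : Type :=
  {p : ℤ × ℤ // (p.1 % 2, p.2 % 6) ∈ ({(0, 0), (0, 2), (1, 3), (1, 5)} : Set (ℤ × ℤ))}

/-- The infinite hexagonal grid. Two vertices are adjacent when the corresponding points of the
plane are at Euclidean distance `1`, that is,
`((i - i') * √3 / 2) ^ 2 + ((j - j') / 2) ^ 2 = 1`. -/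
def hexGrid : SimpleGraph HexVertex where
  Adj u v := 3 * (u.1.1 - v.1.1) ^ 2 + (u.1.2 - v.1.2) ^ 2 = 4
  symm := ⟨fun u v h => by linarith [h]⟩
  loopless := ⟨fun u h => by simp at h⟩

end Firefighter

/-
Let `g` be a function that is at most `0` at the start of the fire and grows by at most one along
the edges inside a region `R`. The fire stays in `R` if every exit `v ∉ R` is protected on turn
`2 * (g u + 1)` or earlier, for each neighbor `u ∈ R` of `v`: by induction it cannot reach `u`
before turn `2 * g u + 1`.

The hexagonal grid is drawn as a brick wall on `ℤ × ℤ` with `f` at the origin. The barrier is built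
one vertex at a time. At first it is a wedge opening to the east, of angle `120°` in the hexagonal
grid, in which each vertex is protected at the last moment and does not depend on `τ`. The extra
firefighter puts the barrier one turn ahead from then on, which is just enough to keep the fire in
a horizontal strip by building two parallel walls. Then the lower wall is abandoned: all the effort
goes into the upper wall, which is led clockwise around the fire and back to the wedge, while the
fire has to come around the end of the lower wall. Up to bounded errors and a factor `τ`, the
closed curve has the corners `(0, 0)`, `(1, 1)`, `(27, 1)`, `(30, -2)`, `(25, -7)`, `(7, -7)`, and
the lower wall runs from `(1, -1)` to `(25, -1)`.
-/

namespace Firefighter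

section Confinement

variable {V W : Type*} {G : SimpleGraph V} {H : SimpleGraph W} {F₀ : Set V} {A : ℕ → Finset V}
  {R : Set V} {g : V → ℤ}

/-- The moves `A` confine the fire to the region `R`, as certified by the potential `g`: the fire
cannot reach `v ∈ R` before turn `2 * g v + 1`, and the moves protect every exit of `R` before the
fire can use it, without touching `R` itself. -/
structure Confines (G : SimpleGraph V) (F₀ : Set V) (A : ℕ → Finset V) (R : Set V) (g : V → ℤ) :
    Prop where
  start_subset : F₀ ⊆ R
  start_nonpos : ∀ v ∈ F₀, g v ≤ 0
  le_add_one : ∀ u ∈ R, ∀ v ∈ R, G.Adj u v → g v ≤ g u + 1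
  notMem : ∀ s, 1 ≤ s → ∀ v ∈ A s, v ∉ R
  exit : ∀ u ∈ R, ∀ v ∉ R, G.Adj u v → ∃ s : ℕ, 1 ≤ s ∧ (s : ℤ) ≤ g u + 1 ∧ v ∈ A s

theorem Confines.mem_and_le_of_mem_fireOn (h : Confines G F₀ A R g) :
    ∀ (n : ℕ) {v : V}, v ∈ fireOn G F₀ A n → v ∈ R ∧ 2 * g v ≤ (n - 1 : ℕ)
  | 0, v, hv | 1, v, hv => ⟨h.start_subset hv, by have := h.start_nonpos v hv; omega⟩
  | n + 2, v, hv => by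
    rw [fireOn] at hv
    split_ifs at hv with heven
    · obtain ⟨hvR, hgv⟩ := h.mem_and_le_of_mem_fireOn (n + 1) hv
      exact ⟨hvR, by omega⟩
    obtain ⟨hv | ⟨u, hu, huv⟩, hprot⟩ := hv
    · obtain ⟨hvR, hgv⟩ := h.mem_and_le_of_mem_fireOn (n + 1) hv
      exact ⟨hvR, by omega⟩
    obtain ⟨huR, hgu⟩ := h.mem_and_le_of_mem_fireOn (n + 1) hu
    -- As `n` is odd, `2 * g u ≤ n` gives `2 * (g u + 1) ≤ n + 1`.
    rw [Nat.even_iff] at heven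
    have hvR : v ∈ R := by
      by_contra hvR
      obtain ⟨s, hs, hsg, hvs⟩ := h.exit u huR v hvR huv
      exact hprot ⟨s, hs, by omega, hvs⟩
    exact ⟨hvR, by have := h.le_add_one u huR v hvR huv; omega⟩

theorem Confines.fireOn_subset (h : Confines G F₀ A R g) (n : ℕ) : fireOn G F₀ A n ⊆ R :=
  fun _ hv => (h.mem_and_le_of_mem_fireOn n hv).1

theorem Confines.isLegal (h : Confines G F₀ A R g) {b : ℕ → ℕ}
    (hcard : ∀ t, 1 ≤ t → (A t).card ≤ b t) : IsLegal G F₀ b A :=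
  fun t ht => ⟨hcard t ht, fun v hv hfire => h.notMem t ht v hv (h.fireOn_subset _ hfire)⟩

theorem isSavedOn_of_exits_subset_protectedOn {n : ℕ} (hfire : fireOn G F₀ A n ⊆ R)
    (hexit : ∀ u ∈ R, ∀ v ∉ R, G.Adj u v → v ∈ protectedOn A n) {v : V} (hv : v ∉ R) :
    IsSavedOn G F₀ A n v := by
  by_cases hprot : v ∈ protectedOn A n
  · exact Or.inl hprot
  refine Or.inr ⟨hprot, fun u hu hburn ⟨w⟩ => ?_⟩
  obtain ⟨d, -, hfst, hsnd⟩ :=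
    w.exists_boundary_dart (Subtype.val ⁻¹' Rᶜ) hv (not_not_intro (hfire hburn))
  exact d.fst.2 (hexit d.snd (not_not.1 hsnd) d.fst hfst d.adj.symm)

theorem Confines.isContained (h : Confines G F₀ A R g) (hR : R.Finite) : IsContained G F₀ A := by
  obtain ⟨M, hM⟩ := (hR.image g).bddAbove
  refine ⟨2 * M.toNat + 2, by omega, hR.subset fun v hv => ?_⟩
  by_contra hvR
  refine hv (isSavedOn_of_exits_subset_protectedOn (h.fireOn_subset _)
    (fun u hu w hw huw => ?_) hvR)
  obtain ⟨s, hs, hsg, hws⟩ := h.exit u hu w hw huw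
  have hgu : g u ≤ M := hM (Set.mem_image_of_mem g hu)
  exact ⟨s, hs, by omega, hws⟩

theorem Confines.comap {F₁ : Set W} {B : ℕ → Finset W} {S : Set W} {k : W → ℤ}
    (h : Confines H F₁ B S k) (e : G ≃g H) (hF : Set.MapsTo e F₀ F₁) :
    Confines G F₀ (fun t => (B t).map e.symm.toEquiv.toEmbedding) (e ⁻¹' S) (k ∘ e) where
  start_subset _ hv := h.start_subset (hF hv)
  start_nonpos _ hv := h.start_nonpos _ (hF hv)
  le_add_one u hu v hv huv := h.le_add_one _ hu _ hv (e.map_adj_iff.2 huv)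
  notMem s hs v hv := h.notMem s hs _ (Finset.mem_map_equiv.1 hv)
  exit u hu v hv huv := by
    obtain ⟨s, hs, hsg, hvs⟩ := h.exit _ hu _ hv (e.map_adj_iff.2 huv)
    exact ⟨s, hs, hsg, Finset.mem_map_equiv.2 hvs⟩

end Confinement

section Moves

variable {V : Type*} [DecidableEq V]

/-- The `i`-th vertex of a sequence is protected on turn `2 * protectionTurn τ i` when the vertices
are protected in order, two of them on turn `2 * τ` and one on every other even turn. -/
def protectionTurn (τ i : ℕ) : ℕ := if i ≤ τ then i else i - 1

/-- The vertices of the sequence `w` that are protected on turn `2 * t` when they are protected in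
order, two of them on turn `2 * τ` and one on every other even turn. -/
def sequentialMoves (τ : ℕ) (w : ℕ → V) (t : ℕ) : Finset V :=
  ({i ∈ {t, t + 1} | protectionTurn τ i = t} : Finset ℕ).image w

theorem mem_sequentialMoves {τ t : ℕ} {w : ℕ → V} {v : V} :
    v ∈ sequentialMoves τ w t ↔ ∃ i, protectionTurn τ i = t ∧ w i = v := by
  have hturn : ∀ i, protectionTurn τ i = t → i = t ∨ i = t + 1 := by grind [protectionTurn]
  simp only [sequentialMoves, Finset.mem_image, Finset.mem_filter, Finset.mem_insert,
    Finset.mem_singleton]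
  exact exists_congr fun i => ⟨fun h => ⟨h.1.2, h.2⟩, fun h => ⟨⟨hturn i h.1, h.1⟩, h.2⟩⟩

theorem card_sequentialMoves_le (τ : ℕ) (w : ℕ → V) (t : ℕ) :
    (sequentialMoves τ w t).card ≤ if t = τ then 2 else 1 := by
  refine Finset.card_image_le.trans ?_
  split_ifs with ht
  · exact (Finset.card_filter_le _ _).trans Finset.card_le_two
  · exact Finset.card_le_one.2 (by grind [protectionTurn])

theorem sequentialMoves_of_lt {τ t : ℕ} (w : ℕ → V) (h : t < τ) :
    sequentialMoves τ w t = {w t} := by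
  have hturn : ∀ i, protectionTurn τ i = t ↔ i = t := by grind [protectionTurn]
  ext v
  simp [mem_sequentialMoves, hturn, eq_comm]

end Moves

section BrickWall

/-- The brick wall, a drawing of the hexagonal grid on `ℤ × ℤ` whose rows are horizontal lines and
in which `(x, y)` is joined to `(x, y + 1)` when `x + y` is even. -/
def brickWall : SimpleGraph (ℤ × ℤ) where
  Adj p q :=
    (q.2 = p.2 ∧ (q.1 = p.1 + 1 ∨ q.1 = p.1 - 1)) ∨
      (q.1 = p.1 ∧
        (((p.1 + p.2) % 2 = 0 ∧ q.2 = p.2 + 1) ∨ ((p.1 + p.2) % 2 = 1 ∧ q.2 = p.2 - 1)))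
  symm := ⟨fun p q h => by omega⟩
  loopless := ⟨fun p h => by omega⟩

theorem brickWall_adj {p q : ℤ × ℤ} :
    brickWall.Adj p q ↔ (q.2 = p.2 ∧ (q.1 = p.1 + 1 ∨ q.1 = p.1 - 1)) ∨
      (q.1 = p.1 ∧
        (((p.1 + p.2) % 2 = 0 ∧ q.2 = p.2 + 1) ∨ ((p.1 + p.2) % 2 = 1 ∧ q.2 = p.2 - 1))) :=
  Iff.rfl

theorem exists_brickWall_iso_apply_eq_zero (p : ℤ × ℤ) :
    ∃ e : brickWall ≃g brickWall, e p = 0 := by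
  rcases Int.emod_two_eq_zero_or_one (p.1 + p.2) with hp | hp
  · refine ⟨⟨(Equiv.subRight p.1).prodCongr (Equiv.subRight p.2), fun {u v} => ?_⟩,
      Prod.ext (sub_self _) (sub_self _)⟩
    simp only [brickWall_adj, Equiv.prodCongr_apply, Prod.map, Equiv.subRight_apply]
    omega
  · refine ⟨⟨(Equiv.subRight p.1).prodCongr (Equiv.subLeft p.2), fun {u v} => ?_⟩,
      Prod.ext (sub_self _) (sub_self _)⟩
    simp only [brickWall_adj, Equiv.prodCongr_apply, Prod.map, Equiv.subRight_apply,
      Equiv.subLeft_apply]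
    omega

theorem HexVertex.mod_cases (v : HexVertex) :
    (v.1.1 % 2 = 0 ∧ v.1.2 % 6 = 0) ∨ (v.1.1 % 2 = 0 ∧ v.1.2 % 6 = 2) ∨
      (v.1.1 % 2 = 1 ∧ v.1.2 % 6 = 3) ∨ (v.1.1 % 2 = 1 ∧ v.1.2 % 6 = 5) := by
  simpa [Prod.ext_iff] using v.2

/-- The coordinates in the brick wall of the vertices of the hexagonal grid: row `y` consists of the
vertices at heights `3 * y - 1` and `3 * y`, which form a zigzag. -/
def hexVertexEquiv : HexVertex ≃ ℤ × ℤ where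
  toFun v := (v.1.1, (v.1.2 + 1) / 3)
  invFun p := ⟨(p.1, if (p.1 + p.2) % 2 = 0 then 3 * p.2 else 3 * p.2 - 1), by
    simp only [Set.mem_insert_iff, Set.mem_singleton_iff, Prod.mk.injEq]
    split_ifs <;> omega⟩
  left_inv v := by
    have := v.mod_cases
    refine Subtype.ext (Prod.ext rfl ?_)
    dsimp only
    split_ifs <;> omega
  right_inv p := by
    refine Prod.ext rfl ?_
    dsimp only
    split_ifs <;> omega

theorem three_mul_sq_add_sq_eq_four_iff {a b : ℤ} :
    3 * a ^ 2 + b ^ 2 = 4 ↔ ((a = 1 ∨ a = -1) ∧ (b = 1 ∨ b = -1)) ∨ a = 0 ∧ (b = 2 ∨ b = -2) := by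
  refine ⟨fun h => ?_, ?_⟩
  · have ha : -1 ≤ a ∧ a ≤ 1 := abs_le.1 (sq_le_one_iff_abs_le_one a |>.1 (by nlinarith))
    obtain ⟨ha₁, ha₂⟩ := ha
    have hb : -2 ≤ b ∧ b ≤ 2 := abs_le.1 (abs_le_of_sq_le_sq (by nlinarith) (by norm_num))
    obtain ⟨hb₁, hb₂⟩ := hb
    interval_cases a <;> interval_cases b <;> omega
  · rintro (⟨rfl | rfl, rfl | rfl⟩ | ⟨rfl, rfl | rfl⟩) <;> norm_num

/-- The hexagonal grid is isomorphic to the brick wall, through the coordinates `hexVertexEquiv`. -/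
def hexGridIso : hexGrid ≃g brickWall where
  toEquiv := hexVertexEquiv
  map_rel_iff' {u v} := by
    have hu := u.mod_cases
    have hv := v.mod_cases
    change brickWall.Adj (u.1.1, (u.1.2 + 1) / 3) (v.1.1, (v.1.2 + 1) / 3) ↔
      3 * (u.1.1 - v.1.1) ^ 2 + (u.1.2 - v.1.2) ^ 2 = 4
    rw [three_mul_sq_add_sq_eq_four_iff, brickWall_adj]
    omega

theorem exists_hexGrid_iso_apply_eq_zero (f : HexVertex) :
    ∃ e : hexGrid ≃g brickWall, e f = 0 := by
  obtain ⟨e, he⟩ := exists_brickWall_iso_apply_eq_zero (hexGridIso f)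
  exact ⟨hexGridIso.trans e, he⟩

end BrickWall

section Barrier

variable {τ x y : ℤ}

/-- The region in which the fire is confined: a hexagon without the vertices of the lower wall of
the strip, which are in the row `-τ - 1`. -/
def region (τ : ℤ) : Set (ℤ × ℤ) :=
  {p | 0 ≤ p.1 + p.2 ∧ p.1 + p.2 ≤ 28 * τ + 1 ∧ -1 ≤ p.1 - p.2 ∧ p.1 - p.2 ≤ 32 * τ + 2 ∧
    -7 * τ - 1 ≤ p.2 ∧ p.2 ≤ τ ∧ ¬ (p.2 = -τ - 1 ∧ p.1 ≤ 25 * τ ∧ (p.1 + p.2) % 2 = 0)}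

theorem mem_region : (x, y) ∈ region τ ↔
    0 ≤ x + y ∧ x + y ≤ 28 * τ + 1 ∧ -1 ≤ x - y ∧ x - y ≤ 32 * τ + 2 ∧
      -7 * τ - 1 ≤ y ∧ y ≤ τ ∧ ¬ (y = -τ - 1 ∧ x ≤ 25 * τ ∧ (x + y) % 2 = 0) :=
  Iff.rfl

theorem region_finite (τ : ℤ) : (region τ).Finite := by
  refine (Set.finite_Icc ((-1, -7 * τ - 1) : ℤ × ℤ) (30 * τ + 1, τ)).subset fun ⟨x, y⟩ hp => ?_
  rw [mem_region] at hp
  simp only [Set.mem_Icc, Prod.le_def]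
  omega

/-- The vertices of the barrier, in the order in which they are protected: the two sides of the
wedge, the two walls of the strip, and then, clockwise, the rest of the hexagon. In a row every
other vertex is skipped, since it has no neighbor on the side of the fire. -/
def barrier (τ i : ℤ) : ℤ × ℤ :=
  if i ≤ 2 * τ + 1 then if i % 2 = 0 then (i / 2 - 2, i / 2) else (i / 2 - 1, -(i / 2))
  else if i ≤ 26 * τ + 1 then (i - τ - 2, if i % 2 = 0 then τ + 1 else -τ - 1)
  else if i ≤ 27 * τ + 2 then (2 * i - 27 * τ - 4, τ + 1)
  else if i ≤ 30 * τ + 3 then (i - 1, 28 * τ + 3 - i)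
  else if i ≤ 35 * τ + 4 then (60 * τ + 6 - i, 28 * τ + 3 - i)
  else if i ≤ 44 * τ + 4 then (95 * τ + 10 - 2 * i, -7 * τ - 2)
  else (51 * τ + 5 - i, i - 51 * τ - 6)

theorem barrier_notMem_region (τ i : ℤ) : barrier τ i ∉ region τ := by
  rw [barrier]
  split_ifs <;> rw [mem_region] <;> omega

theorem barrier_eq_of_le {τ' i : ℤ} (hi : 0 ≤ i) (h : i ≤ τ) (h' : i ≤ τ') :
    barrier τ i = barrier τ' i := by
  rw [barrier, barrier, if_pos (show i ≤ 2 * τ + 1 by omega),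
    if_pos (show i ≤ 2 * τ' + 1 by omega)]

/-- The distance from the origin in the strip, where the fire moves away from the wedge. -/
def stripArrival (p : ℤ × ℤ) : ℤ := p.1 + |p.2|

/-- A lower bound for the time that the fire needs to reach a vertex below the strip around the
point `(25 * τ + 1, -τ)`, where the lower wall of the strip ends. The three terms agree at that
point and measure the progress to the southeast, the southwest and the south; the last one grows by
two per row, since the fire needs a horizontal step between two steps down. -/
def lowerArrival (τ : ℤ) (p : ℤ × ℤ) : ℤ :=
  max (p.1 - p.2) (max (50 * τ + 2 - p.1 - p.2)
    (24 * τ + 1 - 2 * p.2 - if (p.1 + p.2) % 2 = 0 then 1 else 0))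

/-- A lower bound for the time that the fire needs to reach a vertex inside `region τ`. -/
def arrival (τ : ℤ) (p : ℤ × ℤ) : ℤ :=
  if -τ ≤ p.2 then stripArrival p else lowerArrival τ p

theorem stripArrival_le_of_adj {p q : ℤ × ℤ} (h : brickWall.Adj p q) :
    stripArrival q ≤ stripArrival p + 1 := by
  simp only [brickWall_adj, stripArrival, abs_eq_max_neg] at h ⊢
  omega

theorem lowerArrival_le_of_adj {p q : ℤ × ℤ} (h : brickWall.Adj p q) :
    lowerArrival τ q ≤ lowerArrival τ p + 1 := by
  simp only [brickWall_adj, lowerArrival] at h ⊢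
  omega

theorem lowerArrival_eq_stripArrival_add_one (hτ : 0 ≤ τ) (hx : 25 * τ + 1 ≤ x)
    (hxy : (x - τ) % 2 = 1) :
    lowerArrival τ (x, -τ - 1) = stripArrival (x, -τ) + 1 := by
  simp only [lowerArrival, stripArrival, abs_eq_max_neg]
  omega

theorem arrival_le_of_adj {p q : ℤ × ℤ} (hp : p ∈ region τ) (hq : q ∈ region τ)
    (h : brickWall.Adj p q) : arrival τ q ≤ arrival τ p + 1 := by
  obtain ⟨x, y⟩ := p
  obtain ⟨a, b⟩ := q
  simp only [arrival]
  split_ifs with hb hy hy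
  · exact stripArrival_le_of_adj h
  · rw [mem_region] at hp
    simp only [brickWall_adj] at h
    obtain ⟨rfl, rfl, rfl⟩ : y = -τ - 1 ∧ b = -τ ∧ a = x := by omega
    have := lowerArrival_eq_stripArrival_add_one (x := a) (by omega : 0 ≤ τ) (by omega) (by omega)
    omega
  · rw [mem_region] at hq
    simp only [brickWall_adj] at h
    obtain ⟨rfl, rfl, rfl⟩ : b = -τ - 1 ∧ y = -τ ∧ a = x := by omega
    exact (lowerArrival_eq_stripArrival_add_one (by omega) (by omega) (by omega)).le
  · exact lowerArrival_le_of_adj h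

/-- The edge from `p` to `q` is blocked before the fire can use it: `q` is in the barrier, where its
position is at most `arrival τ p + 1`, or one more if it comes after the extra firefighter. -/
def IsBlockedInTime (τ : ℤ) (p q : ℤ × ℤ) : Prop :=
  ∃ i : ℤ, 1 ≤ i ∧ barrier τ i = q ∧ (i ≤ arrival τ p + 1 ∨ τ < i ∧ i ≤ arrival τ p + 2)

theorem isBlockedInTime_upperWedge (h : x - y = -1) (h₁ : 1 ≤ y) (h₂ : y ≤ τ) :
    IsBlockedInTime τ (x, y) (x - 1, y) := by
  refine ⟨2 * y, by omega, by grind [barrier], ?_⟩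
  simp only [arrival, stripArrival, abs_eq_max_neg]
  omega

theorem isBlockedInTime_lowerWedge (h : x + y = 0) (h₁ : -τ ≤ y) (h₂ : y ≤ 0) :
    IsBlockedInTime τ (x, y) (x - 1, y) := by
  refine ⟨-2 * y + 1, by omega, by grind [barrier], ?_⟩
  simp only [arrival, stripArrival, abs_eq_max_neg]
  omega

theorem isBlockedInTime_lowerWall (h : (x - τ) % 2 = 1) (h₁ : τ + 1 ≤ x)
    (h₂ : x ≤ 25 * τ) {p : ℤ × ℤ} (hp : brickWall.Adj p (x, -τ - 1)) :
    IsBlockedInTime τ p (x, -τ - 1) := by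
  refine ⟨x + τ + 2, by omega, by grind [barrier], ?_⟩
  simp only [arrival, stripArrival, lowerArrival, abs_eq_max_neg, brickWall_adj] at hp ⊢
  omega

theorem isBlockedInTime_upperWall (h : (x + τ) % 2 = 0) (h₁ : τ ≤ x) (h₂ : x ≤ 27 * τ) :
    IsBlockedInTime τ (x, τ) (x, τ + 1) := by
  rcases lt_or_ge x (25 * τ) with hx | hx
  · refine ⟨x + τ + 2, by omega, by grind [barrier], ?_⟩
    simp only [arrival, stripArrival, abs_eq_max_neg]
    omega
  · refine ⟨(x + 27 * τ + 4) / 2, by omega, by grind [barrier], ?_⟩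
    simp only [arrival, stripArrival, abs_eq_max_neg]
    omega

theorem isBlockedInTime_upperRight (h : x + y = 28 * τ + 1) (h₁ : -2 * τ ≤ y)
    (h₂ : y ≤ τ) : IsBlockedInTime τ (x, y) (x + 1, y) := by
  refine ⟨28 * τ + 3 - y, by omega, by grind [barrier], ?_⟩
  simp only [arrival, stripArrival, lowerArrival, abs_eq_max_neg]
  omega

theorem isBlockedInTime_lowerRight (h : x - y = 32 * τ + 2) (h₁ : -7 * τ - 1 ≤ y)
    (h₂ : y ≤ -2 * τ - 1) : IsBlockedInTime τ (x, y) (x + 1, y) := by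
  refine ⟨28 * τ + 3 - y, by omega, by grind [barrier], ?_⟩
  simp only [arrival, stripArrival, lowerArrival, abs_eq_max_neg]
  omega

theorem isBlockedInTime_bottom (h : (x - τ) % 2 = 0) (h₁ : 7 * τ + 2 ≤ x) (h₂ : x ≤ 25 * τ) :
    IsBlockedInTime τ (x, -7 * τ - 1) (x, -7 * τ - 2) := by
  refine ⟨(95 * τ + 10 - x) / 2, by omega, by grind [barrier], ?_⟩
  simp only [arrival, lowerArrival]
  omega

theorem isBlockedInTime_lowerLeft (h : x + y = 0) (h₁ : -7 * τ - 1 ≤ y)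
    (h₂ : y ≤ -τ - 2) : IsBlockedInTime τ (x, y) (x - 1, y) := by
  refine ⟨51 * τ + 6 + y, by omega, by grind [barrier], ?_⟩
  simp only [arrival, lowerArrival]
  omega

theorem isBlockedInTime_of_adj (hτ : 1 ≤ τ) {p q : ℤ × ℤ} (hp : p ∈ region τ) (hq : q ∉ region τ)
    (h : brickWall.Adj p q) : IsBlockedInTime τ p q := by
  obtain ⟨x, y⟩ := p
  obtain ⟨a, b⟩ := q
  by_cases hwall : b = -τ - 1 ∧ τ + 1 ≤ a ∧ a ≤ 25 * τ ∧ (a - τ) % 2 = 1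
  · obtain ⟨rfl, h₁, h₂, hpar⟩ := hwall
    exact isBlockedInTime_lowerWall hpar h₁ h₂ h
  rw [mem_region] at hp hq
  simp only [brickWall_adj] at h
  obtain ⟨rfl, rfl | rfl⟩ | ⟨rfl, ⟨hpar, rfl⟩ | ⟨hpar, rfl⟩⟩ := h
  · rcases (by omega : x + b = 28 * τ + 1 ∨ x - b = 32 * τ + 2) with hr | hr
    · exact isBlockedInTime_upperRight hr (by omega) (by omega)
    · exact isBlockedInTime_lowerRight hr (by omega) (by omega)
  · rcases (by omega : x - b = -1 ∨ x + b = 0) with hl | hl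
    · exact isBlockedInTime_upperWedge hl (by omega) (by omega)
    · rcases le_or_gt (-τ) b with hb | hb
      · exact isBlockedInTime_lowerWedge hl hb (by omega)
      · exact isBlockedInTime_lowerLeft hl (by omega) (by omega)
  · obtain rfl : y = τ := by omega
    exact isBlockedInTime_upperWall hpar (by omega) (by omega)
  · obtain rfl : y = -7 * τ - 1 := by omega
    convert isBlockedInTime_bottom (x := a) (τ := τ) (by omega) (by omega) (by omega) using 2
    omega

theorem confines_sequentialMoves_barrier {τ : ℕ} (hτ : 1 ≤ τ) :
    Confines brickWall {0} (sequentialMoves τ fun i => barrier τ i) (region τ) (arrival τ) where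
  start_subset := by
    rw [Set.singleton_subset_iff, Prod.zero_eq_mk, mem_region]
    omega
  start_nonpos := by simp [arrival, stripArrival]
  le_add_one _ hp _ hq h := arrival_le_of_adj hp hq h
  notMem s _ p hp := by
    obtain ⟨i, -, rfl⟩ := mem_sequentialMoves.1 hp
    exact barrier_notMem_region τ i
  exit p hp q hq h := by
    obtain ⟨i, hi, hiq, hle⟩ := isBlockedInTime_of_adj (by omega) hp hq h
    lift i to ℕ using by omega
    refine ⟨protectionTurn τ i, ?_, ?_, mem_sequentialMoves.2 ⟨i, rfl, hiq⟩⟩ <;>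
      rw [protectionTurn] <;> split_ifs <;> omega

theorem isNonanticipating_sequentialMoves_barrier :
    IsNonanticipating fun τ => sequentialMoves τ fun i => barrier τ i := by
  intro τ τ' t _ h h'
  simp only [sequentialMoves_of_lt _ h, sequentialMoves_of_lt _ h',
    barrier_eq_of_le (τ := τ) (τ' := τ') (i := t) (by omega) (by omega) (by omega)]

end Barrier

end Firefighter

theorem theorem2 (f : Firefighter.HexVertex) :
    ∃ A : ℕ → ℕ → Finset Firefighter.HexVertex,
      Firefighter.IsNonanticipating A ∧
      ∀ τ : ℕ, 1 ≤ τ →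
        Firefighter.IsLegal Firefighter.hexGrid {f} (fun t => if t = τ then 2 else 1) (A τ) ∧
        Firefighter.IsContained Firefighter.hexGrid {f} (A τ) := by
  open Firefighter in
  obtain ⟨e, hef⟩ := exists_hexGrid_iso_apply_eq_zero f
  refine ⟨fun τ t => (sequentialMoves τ (fun i => barrier τ i) t).map e.symm.toEquiv.toEmbedding,
    fun τ τ' t ht h h' => ?_, fun τ hτ => ?_⟩
  · exact congrArg _ (isNonanticipating_sequentialMoves_barrier τ τ' t ht h h')
  · have hconf := (confines_sequentialMoves_barrier hτ).comap e (Set.mapsTo_singleton.2 hef)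
    refine ⟨hconf.isLegal fun t _ => ?_, hconf.isContained ?_⟩
    · rw [Finset.card_map]
      exact card_sequentialMoves_le τ _ t
    · exact (region_finite τ).preimage e.injective.injOn
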